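/- For $x\in\mathbb{R}^d$ write $\|x\|_p=\big(\sum_{i=1}^d|x_i|^p\big)^{1/p}$. For a finite $P\subseteq\mathbb{R}^d$ and $r>0$, an $\ell^p$-isometric copy of $rP$ is a set $Y\subseteq\mathbb{R}^d$ for which there is a bijection $\phi\colon P\to Y$ with $\|\phi(u)-\phi(v)\|_p=r\|u-v\|_p$ for all $u,v\in P$. For a measurable $E\subseteq\mathbb{R}^d$ let \[ \underline{\mathrm{d}}(E)=\liminf_{R\to\infty}\frac{|E\cap[-R/2,R/2]^d|}{R^d}, \] and if the limit exists, denote it by $\mathrm{d}(E)$ and call it the density of $E$. Fix integers $d\ge1$ and $p\ge2$. There exists a constant $C_{d,p}\in(0,\infty)$ such that for every sufficiently large integer $n$ there exist a measurable set $E\subseteq\mathbb{R}^d$, a set $P\subseteq\mathbb{R}^d$ of exactly $n$ points contained in a line, and a sequence of positive numbers $(r_j)_j$ with $r_j\to\infty$, such that \[ \underline{\mathrm{d}}(E)\ge 1-C_{d,p}\frac{\log n}{n} \] and $E$ contains no $\ell^p$-isometric copy of $r_jP$ for any $j$. Moreover, if $p$ is even, then the constant $C_{d,p}$ (and the threshold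 for "sufficiently large $n$") can be chosen independently of $d$, and at the same time $E$ can be chosen so that the density $\mathrm{d}(E)$ exists. -/

import Mathlib

open Filter Topology MeasureTheory

namespace LpDensity

noncomputable section

/-- The `ℓ^p` norm `(∑ i, |x i| ^ p) ^ (1 / p)` on `ℝ^d`, as the norm of Mathlib's `PiLp`. -/
def pNorm {d : ℕ} (p : ℕ) (x : Fin d → ℝ) : ℝ :=
  ‖(WithLp.toLp (p : ENNReal) x : PiLp (p : ENNReal) fun _ : Fin d => ℝ)‖

theorem pNorm_eq {d p : ℕ} (hp : 0 < p) (x : Fin d → ℝ) :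
    pNorm p x = (∑ i, |x i| ^ p) ^ (1 / (p : ℝ)) := by
  have h : 0 < (p : ENNReal).toReal := by simpa using hp
  simp [pNorm, PiLp.norm_eq_sum h]

/-- `Y` is an `ℓ^p`-isometric copy of the dilate `r P`. -/
def IsIsometricCopy {d : ℕ} (p : ℕ) (r : ℝ) (P Y : Set (Fin d → ℝ)) : Prop :=
  ∃ φ : (Fin d → ℝ) → (Fin d → ℝ), Set.BijOn φ P Y ∧
    ∀ u ∈ P, ∀ v ∈ P, pNorm p (φ u - φ v) = r * pNorm p (u - v)

/-- `E` contains an `ℓ^p`-isometric copy of `r P`. -/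
def ContainsCopy {d : ℕ} (p : ℕ) (r : ℝ) (P E : Set (Fin d → ℝ)) : Prop :=
  ∃ Y : Set (Fin d → ℝ), Y ⊆ E ∧ IsIsometricCopy p r P Y

/-- The proportion `|E ∩ [-R/2, R/2]^d| / R^d`. -/
def cubeRatio {d : ℕ} (E : Set (Fin d → ℝ)) (R : ℝ) : ℝ :=
  volume.real (E ∩ Set.Icc (fun _ => -R / 2) (fun _ => R / 2)) / R ^ d

/-- The lower asymptotic density of `E`. The ratio lies in `[0, 1]` for `R > 0`, so that this
is the true limit inferior. -/
def lowerDensity {d : ℕ} (E : Set (Fin d → ℝ)) : ℝ :=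
  liminf (cubeRatio E) atTop

/-- `E` has the (actual) asymptotic density `δ`. -/
def HasDensity {d : ℕ} (E : Set (Fin d → ℝ)) (δ : ℝ) : Prop :=
  Tendsto (cubeRatio E) atTop (𝓝 δ)

end

end LpDensity

/-!
The exceptional set is arithmetic: `E` consists of the `x` for which `‖x‖_p ^ p` (for odd `p`,
each of the forms `∑ ± x i ^ p`) stays at distance more than `κ / 2` from the integers, where
`κ = C log n / n`. Such a set has density `1 - κ` because `s ^ p + c` is equidistributed modulo
one, uniformly in `c` (`volume_pow_add_mem_nearInt_le`, `hasDensity_compl_resonantSet`); for odd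
`p` the union over the `2 ^ d` sign patterns costs a factor `2 ^ d` and leaves a bound on the lower
density (`lowerDensity_compl_iUnion_resonantSet_ge`).

Let `P` consist of the points with parameters `t ∈ T`, `T ⊆ ℕ`, on a coordinate axis. Since `ℓ^p`
is strictly convex, an isometric copy of `r P` consists of points `y + r t v` with `‖v‖_p = 1`
(`exists_eq_add_smul_of_dist_eq`). Along it the form whose signs match those of `v` is a polynomial
in `t` with leading coefficient `r ^ p` and otherwise unknown coefficients (`powerForm_add_smul`).
With `r ^ p = α + j + 1` and `t` an integer only `α` matters modulo one. So it suffices to find `n`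
integers and an `α` such that every real polynomial of degree `p` with leading coefficient `α` comes
within `κ / 2` of an integer at one of them (`exists_hitting_finset`).

These integers are chosen at random. Write `t = ∑ x j * q ^ j` with digits `x` in `(ZMod q) ^ p`,
where `q` is a prime of size a power of `n`. With a suitable `α` the polynomial becomes
`(∏ x j) / q` plus functions each of which ignores one digit. Repeated Cauchy–Schwarz bounds its
character sums whatever these functions are (`norm_sum_addChar_mul_prod_le`), so that it is near an
integer for a proportion of at least `κ / 16` of the `t` (`card_filter_near_int_ge`). Up to a
negligible error there are only `n ^ O(1)` polynomials modulo one (`exists_discrete_coeff`), and the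
union bound applies as soon as `n ^ O(1) * (1 - κ / 16) ^ n < 1` (`exists_hitting_tuple`), which
accounts for the logarithm.
-/

namespace LpDensity

/-! ### Character sums over `ZMod q` -/

theorem sum_univ_pi_cons {X M : Type*} [Fintype X] [AddCommMonoid M] {m : ℕ}
    (f : (Fin (m + 1) → X) → M) :
    ∑ x, f x = ∑ y : Fin m → X, ∑ t : X, f (Fin.cons t y) := by
  rw [Finset.sum_comm, ← Fintype.sum_prod_type']
  exact (Fintype.sum_equiv (Fin.consEquiv fun _ => X) _ _ fun _ => rfl).symm

/-- Cauchy–Schwarz in the form that eliminates one variable: the weight `c`, which does not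
depend on `t`, disappears at the price of doubling `t`. -/
theorem norm_sum_mul_sum_sq_le {X Y : Type*} [Fintype X] [Fintype Y] (c : Y → ℂ)
    (hc : ∀ y, ‖c y‖ ≤ 1) (h : X → Y → ℂ) :
    ‖∑ y, c y * ∑ t, h t y‖ ^ 2 ≤
      Fintype.card Y * ∑ t, ∑ s, ‖∑ y, h t y * (starRingEnd ℂ) (h s y)‖ := by
  have h1 : ‖∑ y, c y * ∑ t, h t y‖ ≤ ∑ y, ‖∑ t, h t y‖ := by
    refine (norm_sum_le _ _).trans (Finset.sum_le_sum fun y _ => ?_)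
    rw [norm_mul]
    exact mul_le_of_le_one_left (norm_nonneg _) (hc y)
  have h2 : (∑ y, ‖∑ t, h t y‖) ^ 2 ≤ Fintype.card Y * ∑ y, ‖∑ t, h t y‖ ^ 2 := by
    simpa using sq_sum_le_card_mul_sum_sq (s := (Finset.univ : Finset Y))
      (f := fun y => ‖∑ t, h t y‖)
  have h3 : ((∑ y, ‖∑ t, h t y‖ ^ 2 : ℝ) : ℂ) =
      ∑ t, ∑ s, ∑ y, h t y * (starRingEnd ℂ) (h s y) := by
    have : ∀ y, ((‖∑ t, h t y‖ ^ 2 : ℝ) : ℂ) = ∑ t, ∑ s, h t y * (starRingEnd ℂ) (h s y) := by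
      intro y
      rw [← Finset.sum_mul_sum, ← map_sum, Complex.mul_conj, Complex.normSq_eq_norm_sq]
    rw [Complex.ofReal_sum, Finset.sum_congr rfl fun y _ => this y, Finset.sum_comm]
    exact Finset.sum_congr rfl fun t _ => Finset.sum_comm
  have h4 : ∑ y, ‖∑ t, h t y‖ ^ 2 ≤ ∑ t, ∑ s, ‖∑ y, h t y * (starRingEnd ℂ) (h s y)‖ := by
    have h0 : (0 : ℝ) ≤ ∑ y, ‖∑ t, h t y‖ ^ 2 := Finset.sum_nonneg fun _ _ => sq_nonneg _
    calc ∑ y, ‖∑ t, h t y‖ ^ 2 = ‖((∑ y, ‖∑ t, h t y‖ ^ 2 : ℝ) : ℂ)‖ := by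
          rw [Complex.norm_real, Real.norm_of_nonneg h0]
      _ ≤ _ := by
          rw [h3]
          exact (norm_sum_le _ _).trans (Finset.sum_le_sum fun t _ => norm_sum_le _ _)
  calc ‖∑ y, c y * ∑ t, h t y‖ ^ 2 ≤ (∑ y, ‖∑ t, h t y‖) ^ 2 := by gcongr
    _ ≤ _ := h2
    _ ≤ _ := by gcongr

/-- Square-root cancellation up to iterated square roots: a phase `a x₁ ⋯ x_{m+1}` over `𝔽_q`
does not correlate with products of bounded functions each of which ignores one variable.
Each application of Cauchy–Schwarz removes one of these functions and replaces `a` by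
`a (t - s)`, which vanishes only for a proportion `1 / q` of the pairs. -/
theorem norm_sum_addChar_mul_prod_le {q : ℕ} [Fact q.Prime] :
    ∀ (m : ℕ) (Y : ℝ), 1 ≤ Y → Y ^ 2 ^ m ≤ q → ∀ a : ZMod q, a ≠ 0 →
    ∀ b : Fin (m + 1) → (Fin (m + 1) → ZMod q) → ℂ,
    (∀ j x v, b j (Function.update x j v) = b j x) → (∀ j x, ‖b j x‖ ≤ 1) →
    ‖∑ x, ZMod.stdAddChar (a * ∏ i, x i) * ∏ j, b j x‖ ≤ 2 / Y * (q : ℝ) ^ (m + 1) := by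
  intro m
  induction m with
  | zero =>
    intro Y hY _ a ha b hb _
    have key : ∑ x : Fin (0 + 1) → ZMod q, ZMod.stdAddChar (a * ∏ i, x i) * ∏ j, b j x = 0 := by
      rw [sum_univ_pi_cons]
      refine Finset.sum_eq_zero fun y _ => ?_
      have : ∀ t, b 0 (Fin.cons t y) = b 0 (Fin.cons 0 y) := fun t => by
        rw [← hb 0 (Fin.cons 0 y) t, Fin.update_cons_zero]
      have h0 := AddChar.sum_mulShift a (ZMod.isPrimitive_stdAddChar q)
      simp only [ha, if_false] at h0
      simp [this, ← Finset.sum_mul, mul_comm a, h0]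
    rw [key, norm_zero]
    have : 0 < Y := one_pos.trans_le hY
    positivity
  | succ m ih =>
    intro Y hY hq a ha b hb hb1
    have hq0 : (0 : ℝ) < q := by exact_mod_cast (Fact.out : q.Prime).pos
    have hq2 : (Y ^ 2) ^ 2 ^ m ≤ (q : ℝ) := by rw [← pow_mul, ← pow_succ']; exact hq
    have hY0 : 0 < Y := one_pos.trans_le hY
    have hqY : Y ^ 2 ≤ q := (pow_le_pow_right₀ hY
      (by rw [pow_succ]; have := Nat.one_le_two_pow (n := m); omega)).trans hq
    set h : ZMod q → (Fin (m + 1) → ZMod q) → ℂ := fun t y =>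
      ZMod.stdAddChar (a * (t * ∏ i, y i)) * ∏ j : Fin (m + 1), b j.succ (Fin.cons t y) with hh
    have hb0 : ∀ t y, b 0 (Fin.cons t y) = b 0 (Fin.cons 0 y) := fun t y => by
      rw [← hb 0 (Fin.cons 0 y) t, Fin.update_cons_zero]
    have e1 : ∑ x, ZMod.stdAddChar (a * ∏ i, x i) * ∏ j, b j x =
        ∑ y : Fin (m + 1) → ZMod q, b 0 (Fin.cons 0 y) * ∑ t, h t y := by
      rw [sum_univ_pi_cons]
      refine Finset.sum_congr rfl fun y _ => ?_
      rw [Finset.mul_sum]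
      refine Finset.sum_congr rfl fun t _ => ?_
      rw [Fin.prod_univ_succ (n := m + 1), Fin.prod_univ_succ (n := m + 1), hb0, hh]
      simp only [Fin.cons_zero, Fin.cons_succ]
      ring
    have e2 := norm_sum_mul_sum_sq_le (fun y => b 0 (Fin.cons 0 y)) (fun y => hb1 _ _) h
    rw [← e1] at e2
    have e3 : ∀ t s, ‖∑ y, h t y * (starRingEnd ℂ) (h s y)‖ ≤
        (if t = s then (q : ℝ) ^ (m + 1) else 0) + 2 / Y ^ 2 * (q : ℝ) ^ (m + 1) := by
      intro t s
      have e4 : ∀ y, h t y * (starRingEnd ℂ) (h s y) =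
          ZMod.stdAddChar ((a * (t - s)) * ∏ i, y i) *
          ∏ j : Fin (m + 1), (b j.succ (Fin.cons t y) *
            (starRingEnd ℂ) (b j.succ (Fin.cons s y))) := by
        intro y
        have : (a * (t - s)) * ∏ i, y i = a * (t * ∏ i, y i) + -(a * (s * ∏ i, y i)) := by ring
        rw [this, AddChar.map_add_eq_mul, AddChar.map_neg_eq_conj, Finset.prod_mul_distrib, hh]
        simp only [map_mul, map_prod]
        ring
      have hbd : ∀ (j : Fin (m + 1)) y, ‖b j.succ (Fin.cons t y) *
          (starRingEnd ℂ) (b j.succ (Fin.cons s y))‖ ≤ 1 := by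
        intro j y
        rw [norm_mul, RCLike.norm_conj]
        exact mul_le_one₀ (hb1 _ _) (norm_nonneg _) (hb1 _ _)
      simp only [e4]
      by_cases hts : t = s
      · rw [if_pos hts]
        have : ‖∑ y : Fin (m + 1) → ZMod q, ZMod.stdAddChar ((a * (t - s)) * ∏ i, y i) *
            ∏ j : Fin (m + 1), (b j.succ (Fin.cons t y) *
            (starRingEnd ℂ) (b j.succ (Fin.cons s y)))‖ ≤ (q : ℝ) ^ (m + 1) := by
          refine (norm_sum_le _ _).trans ?_
          refine (Finset.sum_le_card_nsmul _ _ 1 fun y _ => ?_).trans (by simp)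
          rw [norm_mul, AddChar.norm_apply, one_mul, norm_prod]
          exact Finset.prod_le_one (fun _ _ => norm_nonneg _) fun j _ => hbd j y
        have : 0 ≤ 2 / Y ^ 2 * (q : ℝ) ^ (m + 1) := by positivity
        linarith
      · rw [if_neg hts, zero_add]
        refine ih (Y ^ 2) (one_le_pow₀ hY) hq2 (a * (t - s)) (mul_ne_zero ha (sub_ne_zero.2 hts))
          (fun j y => b j.succ (Fin.cons t y) * (starRingEnd ℂ) (b j.succ (Fin.cons s y)))
          ?_ hbd
        intro j y v
        simp only [Fin.cons_update, hb]
    have e5 : ∑ t : ZMod q, ∑ s, ‖∑ y, h t y * (starRingEnd ℂ) (h s y)‖ ≤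
        (q : ℝ) ^ (m + 2) + 2 / Y ^ 2 * (q : ℝ) ^ (m + 3) := by
      refine (Finset.sum_le_sum fun t _ => Finset.sum_le_sum fun s _ => e3 t s).trans ?_
      simp only [Finset.sum_add_distrib, Finset.sum_ite_eq, Finset.mem_univ, if_true,
        Finset.sum_const, Finset.card_univ, ZMod.card, nsmul_eq_mul]
      apply le_of_eq
      ring
    have hcard : (Fintype.card (Fin (m + 1) → ZMod q) : ℝ) = (q : ℝ) ^ (m + 1) := by simp
    rw [hcard] at e2
    refine le_of_sq_le_sq ?_ (by positivity)
    refine e2.trans ((mul_le_mul_of_nonneg_left e5 (by positivity)).trans ?_)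
    have : (q : ℝ) ^ (m + 2) ≤ 1 / Y ^ 2 * (q : ℝ) ^ (m + 3) := by
      rw [pow_succ _ (m + 2), div_mul_eq_mul_div, le_div_iff₀ (by positivity), one_mul]
      gcongr
    calc (q : ℝ) ^ (m + 1) * ((q : ℝ) ^ (m + 2) + 2 / Y ^ 2 * (q : ℝ) ^ (m + 3))
        ≤ (q : ℝ) ^ (m + 1) * (1 / Y ^ 2 * (q : ℝ) ^ (m + 3) + 2 / Y ^ 2 * (q : ℝ) ^ (m + 3)) := by
          gcongr
      _ = 3 / Y ^ 2 * ((q : ℝ) ^ (m + 2)) ^ 2 := by ring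
      _ ≤ 4 / Y ^ 2 * ((q : ℝ) ^ (m + 2)) ^ 2 := by gcongr; norm_num
      _ = (2 / Y * (q : ℝ) ^ (m + 1 + 1)) ^ 2 := by ring

/-- If a map `N` to `ZMod q` has small character sums, it takes values in `A + A` with roughly
the expected frequency at least. Counting with the multiplicity of representations `a + a'`
keeps the Fourier coefficients absolutely summable, by Parseval's identity. -/
theorem card_filter_mem_sumset_ge {q : ℕ} [Fact q.Prime] {X : Type*} [Fintype X]
    (N : X → ZMod q) (A : Finset (ZMod q)) (hA : A.Nonempty) (ε : ℝ)
    (hN : ∀ k : ZMod q, k ≠ 0 → ‖∑ x, ZMod.stdAddChar (k * N x)‖ ≤ ε * Fintype.card X) :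
    ((A.card : ℝ) / q - ε) * Fintype.card X ≤
      ((Finset.univ.filter fun x => ∃ a ∈ A, ∃ a' ∈ A, N x = a + a').card : ℝ) := by
  classical
  have hq0 : (0 : ℝ) < q := by exact_mod_cast (Fact.out : q.Prime).pos
  set ψ : AddChar (ZMod q) ℂ := ZMod.stdAddChar
  have orth : ∀ u : ZMod q, ∑ k, ψ (k * u) = if u = 0 then (q : ℂ) else 0 := fun u => by
    rw [AddChar.sum_mulShift u (ZMod.isPrimitive_stdAddChar q)]; split_ifs <;> simp
  set W : ZMod q → ℂ := fun k => ∑ a ∈ A, ψ (k * -a)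
  have pars : ∑ k, ‖W k‖ ^ 2 = q * A.card := by
    have : ((∑ k, ‖W k‖ ^ 2 : ℝ) : ℂ) = q * A.card := by
      have h1 : ∀ k, ((‖W k‖ ^ 2 : ℝ) : ℂ) = ∑ a ∈ A, ∑ a' ∈ A, ψ (k * (a' - a)) := by
        intro k
        rw [← Complex.normSq_eq_norm_sq, ← Complex.mul_conj, map_sum, Finset.sum_mul_sum]
        refine Finset.sum_congr rfl fun a _ => Finset.sum_congr rfl fun a' _ => ?_
        rw [← AddChar.map_neg_eq_conj, ← AddChar.map_add_eq_mul]
        congr 1; ring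
      rw [Complex.ofReal_sum, Finset.sum_congr rfl fun k _ => h1 k, Finset.sum_comm]
      have h2 : ∀ a ∈ A, ∑ k, ∑ a' ∈ A, ψ (k * (a' - a)) = q := by
        intro a ha
        rw [Finset.sum_comm]
        simp [orth, sub_eq_zero, ha]
      rw [Finset.sum_congr rfl h2]; simp [mul_comm]
    exact_mod_cast this
  -- `S` counts triples `(x, a, a')` with `N x = a + a'`, weighted by `q`.
  set S : ℂ := ∑ k, W k ^ 2 * ∑ x, ψ (k * N x)
  have hS : S = q * ∑ x, ∑ a ∈ A, ∑ a' ∈ A, if N x = a + a' then (1 : ℂ) else 0 := by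
    have h1 : ∀ k, W k ^ 2 * ∑ x, ψ (k * N x) =
        ∑ x, ∑ a ∈ A, ∑ a' ∈ A, ψ (k * (N x - (a + a'))) := by
      intro k
      rw [sq, Finset.sum_mul_sum, Finset.mul_sum]
      refine Finset.sum_congr rfl fun x _ => ?_
      rw [Finset.sum_mul]
      refine Finset.sum_congr rfl fun a _ => ?_
      rw [Finset.sum_mul]
      refine Finset.sum_congr rfl fun a' _ => ?_
      rw [← AddChar.map_add_eq_mul, ← AddChar.map_add_eq_mul]
      congr 1; ring
    simp only [S]
    rw [Finset.sum_congr rfl fun k _ => h1 k, Finset.sum_comm, Finset.mul_sum]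
    refine Finset.sum_congr rfl fun x _ => ?_
    rw [Finset.sum_comm, Finset.mul_sum]
    refine Finset.sum_congr rfl fun a _ => ?_
    rw [Finset.sum_comm, Finset.mul_sum]
    refine Finset.sum_congr rfl fun a' _ => ?_
    simp [orth, sub_eq_zero]
  set G := Finset.univ.filter fun x => ∃ a ∈ A, ∃ a' ∈ A, N x = a + a'
  have up : ‖S‖ ≤ q * (A.card * G.card) := by
    rw [hS, norm_mul, Complex.norm_natCast]
    refine mul_le_mul_of_nonneg_left ?_ hq0.le
    have h1 : ∀ x, ‖∑ a ∈ A, ∑ a' ∈ A, if N x = a + a' then (1 : ℂ) else 0‖ ≤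
        if x ∈ G then (A.card : ℝ) else 0 := by
      intro x
      split_ifs with hx
      · refine (norm_sum_le _ _).trans ((Finset.sum_le_card_nsmul _ _ 1 fun a _ => ?_).trans
          (by simp))
        have : ∀ a', (N x = a + a') ↔ (N x - a = a') := fun a' => by
          rw [sub_eq_iff_eq_add, add_comm]
        simp only [this, Finset.sum_ite_eq]
        split_ifs <;> simp
      · rw [Finset.sum_eq_zero, norm_zero]
        intro a ha
        refine Finset.sum_eq_zero fun a' ha' => if_neg fun h => hx ?_
        simp only [G, Finset.mem_filter, Finset.mem_univ, true_and]
        exact ⟨a, ha, a', ha', h⟩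
    refine (norm_sum_le _ _).trans ((Finset.sum_le_sum fun x _ => h1 x).trans ?_)
    rw [← Finset.sum_filter]
    simp [mul_comm]
  have low : (A.card : ℝ) ^ 2 * Fintype.card X - ε * Fintype.card X * (q * A.card) ≤ ‖S‖ := by
    have h0 : W 0 ^ 2 * ∑ x, ψ (0 * N x) = ((A.card : ℝ) ^ 2 * Fintype.card X : ℝ) := by
      simp [W]
    have h1 : S = W 0 ^ 2 * ∑ x, ψ (0 * N x) +
        ∑ k ∈ Finset.univ.erase 0, W k ^ 2 * ∑ x, ψ (k * N x) :=
      (Finset.add_sum_erase _ _ (Finset.mem_univ _)).symm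
    have h2 : ‖∑ k ∈ Finset.univ.erase 0, W k ^ 2 * ∑ x, ψ (k * N x)‖ ≤
        ε * Fintype.card X * (q * A.card) := by
      have hε : 0 ≤ ε * Fintype.card X := (norm_nonneg _).trans (hN 1 one_ne_zero)
      rw [← pars, Finset.mul_sum]
      refine (norm_sum_le _ _).trans ((Finset.sum_le_sum (g := fun k =>
        ε * Fintype.card X * ‖W k‖ ^ 2) fun k hk => ?_).trans
        (Finset.sum_le_univ_sum_of_nonneg fun k => by positivity))
      rw [norm_mul, norm_pow, mul_comm]
      exact mul_le_mul_of_nonneg_right (hN k (Finset.ne_of_mem_erase hk)) (by positivity)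
    have h3 := norm_sub_le_norm_add (W 0 ^ 2 * ∑ x, ψ (0 * N x))
      (∑ k ∈ Finset.univ.erase 0, W k ^ 2 * ∑ x, ψ (k * N x))
    rw [← h1] at h3
    have h4 : ‖W 0 ^ 2 * ∑ x, ψ (0 * N x)‖ = (A.card : ℝ) ^ 2 * Fintype.card X := by
      rw [h0, Complex.norm_real, Real.norm_of_nonneg (by positivity)]
    linarith
  have hAc : (0 : ℝ) < A.card := by exact_mod_cast hA.card_pos
  have h5 : (A.card : ℝ) * q * (((A.card : ℝ) / q - ε) * Fintype.card X) ≤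
      (A.card : ℝ) * q * G.card := by
    calc (A.card : ℝ) * q * (((A.card : ℝ) / q - ε) * Fintype.card X)
        = (A.card : ℝ) ^ 2 * Fintype.card X - ε * Fintype.card X * (q * A.card) := by
          field_simp
      _ ≤ q * (A.card * G.card) := low.trans up
      _ = _ := by ring
  exact le_of_mul_le_mul_left h5 (by positivity)

/-! ### Polynomials modulo one along digit expansions -/

/-- `h` is a sum of functions each of which ignores one of the variables. These are the functions
that multilinear Cauchy–Schwarz cannot see. -/
def IsSumOfDegenerate {ι X : Type*} [Fintype ι] [DecidableEq ι] (h : (ι → X) → ℝ) : Prop :=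
  ∃ G : ι → (ι → X) → ℝ, (∀ j x v, G j (Function.update x j v) = G j x) ∧ ∀ x, h x = ∑ j, G j x

section Degenerate

variable {ι X : Type*} [Fintype ι] [DecidableEq ι]

theorem IsSumOfDegenerate.of_update {h : (ι → X) → ℝ} (j : ι)
    (hj : ∀ x v, h (Function.update x j v) = h x) : IsSumOfDegenerate h := by
  refine ⟨fun i => if i = j then h else 0, fun i x v => ?_, fun x => ?_⟩
  · by_cases hi : i = j
    · subst hi; simp [hj]
    · simp [hi]
  · simp [apply_ite (fun f : (ι → X) → ℝ => f x)]

theorem IsSumOfDegenerate.sum {κ : Type*} (s : Finset κ) {h : κ → (ι → X) → ℝ}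
    (hs : ∀ c ∈ s, IsSumOfDegenerate (h c)) : IsSumOfDegenerate fun x => ∑ c ∈ s, h c x := by
  choose! G hG hG' using hs
  refine ⟨fun j x => ∑ c ∈ s, G c j x, fun j x v => ?_, fun x => ?_⟩
  · exact Finset.sum_congr rfl fun c hc => hG c hc j x v
  · rw [Finset.sum_comm]
    exact Finset.sum_congr rfl fun c hc => hG' c hc x

theorem IsSumOfDegenerate.add {h g : (ι → X) → ℝ} (hh : IsSumOfDegenerate h)
    (hg : IsSumOfDegenerate g) : IsSumOfDegenerate fun x => h x + g x := by
  obtain ⟨G, h1, h2⟩ := hh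
  obtain ⟨H, h3, h4⟩ := hg
  exact ⟨fun j x => G j x + H j x, fun j x v => by simp only [h1, h3],
    fun x => by simp only [Finset.sum_add_distrib, h2, h4]⟩

theorem IsSumOfDegenerate.const_mul {h : (ι → X) → ℝ} (hh : IsSumOfDegenerate h) (a : ℝ) :
    IsSumOfDegenerate fun x => a * h x := by
  obtain ⟨G, h1, h2⟩ := hh
  exact ⟨fun j x => a * G j x, fun j x v => by simp only [h1],
    fun x => by simp only [← Finset.mul_sum, h2]⟩

theorem isSumOfDegenerate_prod_comp {κ : Type*} [Fintype κ] (y : ι → X → ℝ) (c : κ → ι)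
    (hc : ¬ Function.Surjective c) : IsSumOfDegenerate fun x => ∏ i, y (c i) (x (c i)) := by
  simp only [Function.Surjective, not_forall, not_exists] at hc
  obtain ⟨j, hj⟩ := hc
  refine .of_update j fun x v => Finset.prod_congr rfl fun i _ => ?_
  rw [Function.update_of_ne (hj i)]

theorem isSumOfDegenerate_pow_of_lt (y : ι → X → ℝ) {k : ℕ} (hk : k < Fintype.card ι) :
    IsSumOfDegenerate fun x => (∑ j, y j (x j)) ^ k := by
  have : (fun x : ι → X => (∑ j, y j (x j)) ^ k) =
      fun x => ∑ c : Fin k → ι, ∏ i, y (c i) (x (c i)) := by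
    funext x; rw [Fintype.sum_pow]
  rw [this]
  refine .sum _ fun c _ => isSumOfDegenerate_prod_comp y c fun h => ?_
  have := Fintype.card_le_of_surjective c h
  simp at this; omega

theorem isSumOfDegenerate_pow_sub (p : ℕ) (y : Fin p → X → ℝ) :
    IsSumOfDegenerate fun x => (∑ j, y j (x j)) ^ p - p.factorial * ∏ j, y j (x j) := by
  classical
  have hcard : (Finset.univ.filter fun c : Fin p → Fin p => Function.Bijective c).card =
      p.factorial := by
    rw [← Fintype.card_subtype, ← Fintype.card_congr (Equiv.ofBijective
      (fun σ : Equiv.Perm (Fin p) =>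
        (⟨σ, σ.bijective⟩ : {c : Fin p → Fin p // Function.Bijective c}))
      ⟨fun σ τ h => Equiv.coe_fn_injective (congrArg Subtype.val h),
        fun c => ⟨Equiv.ofBijective c.1 c.2, rfl⟩⟩), Fintype.card_perm, Fintype.card_fin]
  have : (fun x : Fin p → X => (∑ j, y j (x j)) ^ p - p.factorial * ∏ j, y j (x j)) =
      fun x => ∑ c ∈ Finset.univ.filter fun c : Fin p → Fin p => ¬ Function.Bijective c,
        ∏ i, y (c i) (x (c i)) := by
    funext x
    rw [Fintype.sum_pow, ← Finset.sum_filter_add_sum_filter_not _ Function.Bijective,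
      Finset.sum_congr rfl fun c hc =>
        (Finset.mem_filter.1 hc).2.prod_comp (fun j => y j (x j))]
    rw [Finset.sum_const, hcard, nsmul_eq_mul, add_sub_cancel_left]
  rw [this]
  refine .sum _ fun c hc => isSumOfDegenerate_prod_comp y c fun h => ?_
  exact (Finset.mem_filter.1 hc).2 (Finite.surjective_iff_bijective.1 h)

end Degenerate

theorem addChar_map_sum {A M κ : Type*} [AddCommMonoid A] [CommMonoid M] (ψ : AddChar A M)
    (s : Finset κ) (f : κ → A) : ψ (∑ i ∈ s, f i) = ∏ i ∈ s, ψ (f i) := by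
  classical
  induction s using Finset.induction_on with
  | empty => simp
  | insert i s hi ih => rw [Finset.sum_insert hi, Finset.prod_insert hi, ψ.map_add_eq_mul, ih]

open Classical in
/-- Along `t = ∑ w j * x j` with `x` ranging over `{0, …, q - 1} ^ p`, any real polynomial of
degree `p` with the leading coefficient given here is `(∏ x j) / q` up to functions that ignore
one variable. Rounding those to multiples of `1 / q` puts the character sum bound at disposal, so
that the polynomial comes close to an integer as often as it should. -/
theorem card_filter_near_int_ge {q p : ℕ} [Fact q.Prime] (hp : 0 < p) {Y : ℝ} (hY : 1 ≤ Y)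
    (hYq : Y ^ 2 ^ (p - 1) ≤ q) (w : Fin p → ℝ) (hw : ∀ j, w j ≠ 0) (c : Fin p → ℝ)
    (α : ℝ) (hα : α = 1 / (q * p.factorial * ∏ j, w j)) {l : ℕ} (hl : 0 < l) (hlq : l ≤ q)
    (t : (Fin p → ZMod q) → ℝ) (ht : ∀ x, t x = ∑ j, w j * (x j).val) :
    ((l : ℝ) / q - 2 / Y) * (q : ℝ) ^ p ≤
      ((Finset.univ.filter fun x => ∃ z : ℤ,
        0 ≤ α * t x ^ p + ∑ k : Fin p, c k * t x ^ (k : ℕ) - z ∧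
        α * t x ^ p + ∑ k : Fin p, c k * t x ^ (k : ℕ) - z ≤
          (2 * l + p) / q).card : ℝ) := by
  classical
  obtain ⟨m, rfl⟩ : ∃ m, p = m + 1 := ⟨p - 1, by omega⟩
  rw [Nat.add_sub_cancel] at hYq
  have hq0 : (0 : ℝ) < q := by exact_mod_cast (Fact.out : q.Prime).pos
  set F : (Fin (m + 1) → ZMod q) → ℝ :=
    fun x => α * t x ^ (m + 1) + ∑ k : Fin (m + 1), c k * t x ^ (k : ℕ) with hF
  obtain ⟨G, hG, hFG⟩ : ∃ G : Fin (m + 1) → (Fin (m + 1) → ZMod q) → ℝ,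
      (∀ j x v, G j (Function.update x j v) = G j x) ∧
      ∀ x, F x = (∏ j, ((x j).val : ℝ)) / q + ∑ j, G j x := by
    set y : Fin (m + 1) → ZMod q → ℝ := fun j v => w j * v.val
    have h1 : IsSumOfDegenerate fun x => α * ((∑ j, y j (x j)) ^ (m + 1) -
        (m + 1).factorial * ∏ j, y j (x j)) +
        ∑ k : Fin (m + 1), c k * (∑ j, y j (x j)) ^ (k : ℕ) :=
      ((isSumOfDegenerate_pow_sub (m + 1) y).const_mul α).add
        (.sum _ fun k _ => (isSumOfDegenerate_pow_of_lt y (by simpa using k.2)).const_mul (c k))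
    obtain ⟨G, hG, h2⟩ := h1
    refine ⟨G, hG, fun x => ?_⟩
    have h3 : α * ((m + 1).factorial * ∏ j, y j (x j)) = (∏ j, ((x j).val : ℝ)) / q := by
      have hw' : ∏ j, w j ≠ 0 := Finset.prod_ne_zero_iff.2 fun j _ => hw j
      have hf : ((m + 1).factorial : ℝ) ≠ 0 := by exact_mod_cast (Nat.factorial_pos _).ne'
      simp only [y]
      rw [Finset.prod_mul_distrib, hα]
      field_simp
    rw [← h2 x, ← h3]
    simp only [hF, ht, y]
    ring
  set N : (Fin (m + 1) → ZMod q) → ZMod q :=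
    fun x => ∏ j, x j + ∑ j, ((⌊q * G j x⌋ : ℤ) : ZMod q) with hN
  set A : Finset (ZMod q) := (Finset.range l).image fun i : ℕ => (i : ZMod q)
  have hAcard : A.card = l := by
    rw [Finset.card_image_of_injOn, Finset.card_range]
    intro a ha b hb hab
    simp only [Finset.coe_range, Set.mem_Iio] at ha hb
    have := (ZMod.natCast_eq_natCast_iff' _ _ _).1 hab
    rwa [Nat.mod_eq_of_lt (ha.trans_le hlq), Nat.mod_eq_of_lt (hb.trans_le hlq)] at this
  have hcardX : (Fintype.card (Fin (m + 1) → ZMod q) : ℝ) = (q : ℝ) ^ (m + 1) := by simp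
  have main := card_filter_mem_sumset_ge N A (Finset.card_pos.1 (by rw [hAcard]; exact hl))
    (2 / Y) (by
      intro k hk
      have h1 : ∀ x, ZMod.stdAddChar (k * N x) = ZMod.stdAddChar (k * ∏ i, x i) *
          ∏ j, ZMod.stdAddChar (k * ((⌊q * G j x⌋ : ℤ) : ZMod q)) := by
        intro x
        rw [hN, ← addChar_map_sum, ← AddChar.map_add_eq_mul, mul_add, Finset.mul_sum]
      simp only [h1]
      rw [hcardX]
      refine norm_sum_addChar_mul_prod_le m Y hY hYq k hk
        (fun j x => ZMod.stdAddChar (k * ((⌊q * G j x⌋ : ℤ) : ZMod q))) ?_ ?_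
      · intro j x v; simp only [hG]
      · intro j x; simp only [AddChar.norm_apply, le_refl])
  rw [hAcard, hcardX] at main
  refine main.trans (Nat.cast_le.2 ?_)
  refine Finset.card_le_card fun x hx => ?_
  simp only [Finset.mem_filter, Finset.mem_univ, true_and, A, Finset.mem_image,
    Finset.mem_range] at hx ⊢
  obtain ⟨_, ⟨a, ha, rfl⟩, _, ⟨b, hb, rfl⟩, hab⟩ := hx
  set M : ℤ := ∏ j, ((x j).val : ℤ) + ∑ j, ⌊q * G j x⌋ with hM
  have h1 : (M : ZMod q) = ((a + b : ℤ) : ZMod q) := by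
    rw [hM]
    push_cast
    simp only [ZMod.natCast_zmod_val]
    exact hab
  rw [eq_comm, ZMod.intCast_eq_intCast_iff_dvd_sub] at h1
  obtain ⟨z, hz⟩ := h1
  have h2 : q * F x = M + ∑ j, Int.fract (q * G j x) := by
    have : ∀ j, (q : ℝ) * G j x = ⌊q * G j x⌋ + Int.fract (q * G j x) := fun j =>
      (Int.floor_add_fract _).symm
    rw [hFG, mul_add, mul_div_cancel₀ _ hq0.ne', Finset.mul_sum,
      Finset.sum_congr rfl fun j _ => this j, Finset.sum_add_distrib, hM]
    push_cast
    ring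
  have h3 : 0 ≤ ∑ j, Int.fract (q * G j x) := Finset.sum_nonneg fun j _ => Int.fract_nonneg _
  have h4 : ∑ j : Fin (m + 1), Int.fract (q * G j x) ≤ (m + 1 : ℕ) := by
    refine (Finset.sum_le_card_nsmul _ _ 1 fun j _ => (Int.fract_lt_one _).le).trans ?_
    simp
  have h5 : (M : ℝ) = a + b + q * z := by
    have : M = a + b + q * z := by linarith
    exact_mod_cast this
  have ha' : (a : ℝ) ≤ l := by exact_mod_cast ha.le
  have hb' : (b : ℝ) ≤ l := by exact_mod_cast hb.le
  have h6 : F x - z = (a + b + ∑ j, Int.fract (q * G j x)) / q := by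
    rw [eq_div_iff hq0.ne']; linarith
  refine ⟨z, ?_, ?_⟩
  · rw [h6]; positivity
  · rw [h6]; gcongr; linarith

/-! ### Hitting sets for polynomials modulo one -/

/-- The union bound: if every member of a finite family of sets has density at least `δ`, some
`n` points meet all of them as soon as the family has fewer than `(1 - δ)⁻ⁿ` members. -/
theorem exists_hitting_tuple {U B : Type*} [Fintype U] [Nonempty U] [Fintype B]
    (G : B → Finset U) (δ : ℝ) (hG : ∀ b, δ * Fintype.card U ≤ (G b).card) (n : ℕ)
    (h : Fintype.card B * (1 - δ) ^ n < 1) : ∃ f : Fin n → U, ∀ b, ∃ i, f i ∈ G b := by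
  classical
  by_contra! hcon
  have hU : (0 : ℝ) < Fintype.card U := by exact_mod_cast Fintype.card_pos
  have h1 : (Finset.univ : Finset (Fin n → U)) ⊆
      Finset.univ.biUnion fun b => Fintype.piFinset fun _ : Fin n => (G b)ᶜ := by
    intro f _
    obtain ⟨b, hb⟩ := hcon f
    simp only [Finset.mem_biUnion, Finset.mem_univ, true_and, Fintype.mem_piFinset,
      Finset.mem_compl]
    exact ⟨b, hb⟩
  have h2 : Fintype.card U ^ n ≤ ∑ b, (G b)ᶜ.card ^ n := by
    refine le_trans ?_ (((Finset.card_le_card h1).trans Finset.card_biUnion_le).trans ?_)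
    · simp
    · exact Finset.sum_le_sum fun b _ => by simp
  have h3 : ∀ b, (((G b)ᶜ.card : ℝ)) ^ n ≤ ((1 - δ) * Fintype.card U) ^ n := by
    intro b
    refine pow_le_pow_left₀ (Nat.cast_nonneg _) ?_ n
    have : ((G b)ᶜ.card : ℝ) + (G b).card = Fintype.card U := by
      exact_mod_cast Finset.card_compl_add_card _
    linarith [hG b]
  have h4 : (Fintype.card U : ℝ) ^ n ≤ Fintype.card B * (1 - δ) ^ n * Fintype.card U ^ n := by
    calc (Fintype.card U : ℝ) ^ n ≤ ∑ b, ((G b)ᶜ.card : ℝ) ^ n := by exact_mod_cast h2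
      _ ≤ ∑ _b : B, ((1 - δ) * Fintype.card U) ^ n := Finset.sum_le_sum fun b _ => h3 b
      _ = _ := by simp [mul_pow, mul_assoc]
  have h5 : (0 : ℝ) < (Fintype.card U : ℝ) ^ n := by positivity
  nlinarith

/-- Modulo integers, coefficients at integer arguments matter only modulo one, so that finitely
many coefficient vectors suffice up to a small error. -/
theorem exists_discrete_coeff {p L : ℕ} (hL : 0 < L) (a : Fin p → ℝ) :
    ∃ b : Fin p → Fin L, ∀ (t : ℕ) (D : ℝ), (∀ k : Fin p, (t : ℝ) ^ (k : ℕ) ≤ D) →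
      ∃ z : ℤ, 0 ≤ ∑ k, a k * (t : ℝ) ^ (k : ℕ) - ∑ k, (b k : ℝ) / L * (t : ℝ) ^ (k : ℕ) - z ∧
        ∑ k, a k * (t : ℝ) ^ (k : ℕ) - ∑ k, (b k : ℝ) / L * (t : ℝ) ^ (k : ℕ) - z ≤ p * D / L := by
  have hL' : (0 : ℝ) < L := by exact_mod_cast hL
  have hLz : (0 : ℤ) < L := by exact_mod_cast hL
  refine ⟨fun k => ⟨(⌊L * a k⌋ % L).toNat, ?_⟩, fun t D hD => ?_⟩
  · zify
    rw [Int.toNat_of_nonneg (Int.emod_nonneg _ hLz.ne')]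
    exact Int.emod_lt_of_pos _ hLz
  · refine ⟨∑ k, ⌊L * a k⌋ / L * (t : ℤ) ^ (k : ℕ), ?_⟩
    have key : ∑ k, a k * (t : ℝ) ^ (k : ℕ) -
        ∑ k : Fin p, (((⌊L * a k⌋ % L).toNat : ℕ) : ℝ) / L * (t : ℝ) ^ (k : ℕ) -
        ((∑ k : Fin p, ⌊L * a k⌋ / L * (t : ℤ) ^ (k : ℕ) : ℤ) : ℝ) =
        ∑ k : Fin p, Int.fract (L * a k) / L * (t : ℝ) ^ (k : ℕ) := by
      rw [Int.cast_sum, ← Finset.sum_sub_distrib, ← Finset.sum_sub_distrib]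
      refine Finset.sum_congr rfl fun k _ => ?_
      have h1 : (((⌊L * a k⌋ % L).toNat : ℕ) : ℝ) = ((⌊L * a k⌋ % L : ℤ) : ℝ) := by
        exact_mod_cast Int.toNat_of_nonneg (Int.emod_nonneg _ hLz.ne')
      have h2 : ((⌊L * a k⌋ % L : ℤ) : ℝ) + L * ((⌊L * a k⌋ / L : ℤ) : ℝ) = ⌊L * a k⌋ := by
        exact_mod_cast Int.emod_add_mul_ediv _ _
      have h3 : (⌊L * a k⌋ : ℝ) + Int.fract (L * a k) = L * a k := Int.floor_add_fract _
      rw [h1]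
      push_cast
      have : a k = (((⌊L * a k⌋ % L : ℤ) : ℝ) + L * ((⌊L * a k⌋ / L : ℤ) : ℝ) +
          Int.fract (L * a k)) / L := by
        rw [h2, h3]; field_simp
      nth_rewrite 1 [this]
      field_simp
      ring
    simp only [key]
    constructor
    · exact Finset.sum_nonneg fun k _ => by have := Int.fract_nonneg (L * a k); positivity
    · refine (Finset.sum_le_card_nsmul _ _ (D / L) fun k _ => ?_).trans (by simp [mul_div_assoc])
      rw [div_mul_eq_mul_div]
      gcongr
      exact (mul_le_of_le_one_left (by positivity) (Int.fract_lt_one _).le).trans (hD k)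

theorem eventually_log_bounds (C D : ℝ) :
    ∀ᶠ n : ℕ in atTop, 2 ≤ Real.log n ∧ C * (Real.log n / n) ≤ 1 ∧ D ≤ n := by
  have h1 : Tendsto (fun n : ℕ => Real.log n) atTop atTop :=
    Real.tendsto_log_atTop.comp tendsto_natCast_atTop_atTop
  have h2 : Tendsto (fun n : ℕ => C * (Real.log n / n)) atTop (𝓝 (C * 0)) :=
    ((Real.isLittleO_log_id_atTop.tendsto_div_nhds_zero).comp
      tendsto_natCast_atTop_atTop).const_mul C
  rw [mul_zero] at h2
  filter_upwards [h1.eventually_ge_atTop 2, h2.eventually_le_const one_pos,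
    tendsto_natCast_atTop_atTop.eventually_ge_atTop D] with n h h' h''
  exact ⟨h, h', h''⟩

theorem sum_pow_mul_lt {q : ℕ} : ∀ {p : ℕ} (x : Fin p → ℕ), (∀ j, x j < q) →
    ∑ j : Fin p, q ^ (j : ℕ) * x j < q ^ p := by
  intro p
  induction p with
  | zero => simp
  | succ p ih =>
    intro x hx
    rw [Fin.sum_univ_castSucc, pow_succ]
    have h1 := ih (fun j => x j.castSucc) fun j => hx _
    have h2 : q ^ p * (x (Fin.last p) + 1) ≤ q ^ p * q := Nat.mul_le_mul_left _ (hx _)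
    rw [mul_add] at h2
    simp only [Fin.val_castSucc, Fin.val_last]
    omega

/-- There are `n` integers and a leading coefficient `α` such that every real polynomial of
degree `p` with leading coefficient `α` comes within `O(log n / n)` of an integer at one of them.
The integers are random elements of `{0, …, q ^ p - 1}` with `q` a power of `n` in size, and the
number of polynomials to be distinguished is also a power of `n`, so that the union bound only
costs the logarithm. -/
theorem exists_hitting_finset (p : ℕ) (hp : 0 < p) : ∃ C : ℝ, 0 < C ∧ ∃ N : ℕ, ∀ n : ℕ, N ≤ n →
    C * (Real.log n / n) ≤ 1 ∧ ∃ T : Finset ℕ, T.card = n ∧ ∃ α : ℝ, 0 < α ∧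
      ∀ a : ℕ → ℝ, ∃ t ∈ T, ∃ z : ℤ,
        |α * (t : ℝ) ^ p + ∑ k ∈ Finset.range p, a k * (t : ℝ) ^ k - z| ≤
          C * (Real.log n / n) / 2 := by
  classical
  -- The coefficient vectors number `L ^ p ≤ n ^ (K * p)`, and a random choice of `n` integers fails
  -- for a given one with probability at most `n ^ (-C / 16)`.
  set K : ℕ := 1 + (1 + 2 ^ (p - 1)) * p ^ 2 with hK
  set C : ℝ := 16 * (K * p + 1) with hC
  have hK1 : (1 : ℝ) ≤ K := by exact_mod_cast Nat.le_add_right 1 _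
  have hp1 : (1 : ℝ) ≤ p := by exact_mod_cast hp
  have hCp : 16 * ((p : ℝ) + 1) ≤ C := by rw [hC]; gcongr; exact le_mul_of_one_le_left (by linarith) hK1
  obtain ⟨N, hN⟩ := eventually_atTop.1 (eventually_log_bounds C (p + 2))
  refine ⟨C, by positivity, N, fun n hn => ?_⟩
  obtain ⟨hlog, hκ1, hnp⟩ := hN n hn
  refine ⟨hκ1, ?_⟩
  set κ : ℝ := C * (Real.log n / n) with hκ
  have hn2 : (2 : ℝ) ≤ n := by linarith
  have hn0 : (0 : ℝ) < n := by linarith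
  have hκn : κ * n = C * Real.log n := by rw [hκ]; field_simp
  have hκ0 : 0 ≤ κ := by rw [hκ]; positivity
  have hκp : 32 * ((p : ℝ) + 1) ≤ κ * n := by
    rw [hκn, show 32 * ((p : ℝ) + 1) = 16 * (p + 1) * 2 by ring]
    exact mul_le_mul hCp hlog zero_le_two (by positivity)
  have hnN2 : 2 ≤ n := by exact_mod_cast hn2
  have hnNp : p ≤ n := by have : (p : ℝ) ≤ n := by linarith
                          exact_mod_cast this
  -- The exponent is what the character sum bound needs for a saving of `2 / n`; Bertrand's postulate
  -- keeps `q` a power of `n` in size.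
  obtain ⟨q, hqp, hq1, hq2⟩ := Nat.exists_prime_lt_and_le_two_mul (n ^ 2 ^ (p - 1)) (by positivity)
  have : Fact q.Prime := ⟨hqp⟩
  have hnq : n ≤ q := (Nat.le_self_pow (by positivity) n).trans hq1.le
  have hnq' : (n : ℝ) ≤ q := by exact_mod_cast hnq
  have hq0 : (0 : ℝ) < q := by linarith
  have hqn : q ≤ n ^ (1 + 2 ^ (p - 1)) := by
    rw [pow_add, pow_one]
    exact hq2.trans (Nat.mul_le_mul_right _ hnN2)
  set L : ℕ := p * q ^ p ^ 2 with hL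
  have hL0 : 0 < L := Nat.mul_pos hp (pow_pos hqp.pos _)
  have hLn : L ≤ n ^ K := by
    calc L ≤ n * (n ^ (1 + 2 ^ (p - 1))) ^ p ^ 2 := Nat.mul_le_mul hnNp (Nat.pow_le_pow_left hqn _)
      _ = n ^ K := by rw [hK, pow_add n 1 (_ * _), pow_one, ← pow_mul]
  -- Twice `l / q` is at most half of the admissible deviation `κ / 2`; the other half absorbs rounding.
  set l : ℕ := ⌊q * κ / 8⌋₊ with hl
  have hqκ : 32 * ((p : ℝ) + 1) ≤ q * κ :=
    hκp.trans (by rw [mul_comm]; gcongr)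
  have hl1 : 0 < l := Nat.floor_pos.2 (by linarith)
  have hll : (l : ℝ) ≤ q * κ / 8 := Nat.floor_le (by positivity)
  have hlu : q * κ / 8 < l + 1 := Nat.lt_floor_add_one _
  have hlq : l ≤ q := by
    have : (l : ℝ) ≤ q := by linarith [mul_le_of_le_one_right hq0.le hκ1]
    exact_mod_cast this
  set tt : (Fin p → ZMod q) → ℕ := fun x => ∑ j : Fin p, q ^ (j : ℕ) * (x j).val with htt
  have httlt : ∀ x, tt x < q ^ p := fun x => sum_pow_mul_lt _ fun j => ZMod.val_lt (x j)
  set w : Fin p → ℝ := fun j => (q : ℝ) ^ (j : ℕ) with hw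
  have hw0 : ∀ j, w j ≠ 0 := fun j => by positivity
  set α : ℝ := 1 / (q * p.factorial * ∏ j, w j) with hα
  have hα0 : 0 < α := by
    have : 0 < ∏ j, w j := Finset.prod_pos fun j _ => by positivity
    positivity
  set G : (Fin p → Fin L) → Finset (Fin p → ZMod q) := fun b => Finset.univ.filter fun x =>
    ∃ z : ℤ,
      0 ≤ α * (tt x : ℝ) ^ p + ∑ k : Fin p, (b k : ℝ) / L * (tt x : ℝ) ^ (k : ℕ) - z ∧
      α * (tt x : ℝ) ^ p + ∑ k : Fin p, (b k : ℝ) / L * (tt x : ℝ) ^ (k : ℕ) - z ≤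
          (2 * l + p) / q with hG
  have hYq : (n : ℝ) ^ 2 ^ (p - 1) ≤ q := by exact_mod_cast hq1.le
  have hGcard : ∀ b, κ / 16 * Fintype.card (Fin p → ZMod q) ≤ (G b).card := by
    intro b
    have h1 := card_filter_near_int_ge hp (by linarith) hYq w hw0 (fun k => (b k : ℝ) / L) α hα
      hl1 hlq (fun x => (tt x : ℝ)) (fun x => by simp [htt, hw])
    have h2 : κ / 16 ≤ (l : ℝ) / q - 2 / n := by
      have e1 : κ / 8 - 1 / n ≤ (l : ℝ) / q := by
        have : κ / 8 - 1 / q ≤ (l : ℝ) / q := by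
          rw [← sub_nonneg]
          have : (l : ℝ) / q - (κ / 8 - 1 / q) = (l + 1 - q * κ / 8) / q := by
            field_simp
            ring
          rw [this]
          exact div_nonneg (by linarith) hq0.le
        have h3 : 1 / (q : ℝ) ≤ 1 / n := one_div_le_one_div_of_le hn0 hnq'
        linarith
      have e2 : 3 / (n : ℝ) ≤ κ / 16 := by
        rw [div_le_div_iff₀ hn0 (by norm_num)]; linarith
      have e3 : 3 / (n : ℝ) = 1 / n + 2 / n := by ring
      linarith
    have h3 : (Fintype.card (Fin p → ZMod q) : ℝ) = (q : ℝ) ^ p := by simp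
    rw [h3]
    refine (mul_le_mul_of_nonneg_right h2 (by positivity)).trans h1
  have hunion : (Fintype.card (Fin p → Fin L) : ℝ) * (1 - κ / 16) ^ n < 1 := by
    have h1 : (Fintype.card (Fin p → Fin L) : ℝ) ≤ (n : ℝ) ^ (K * p) := by
      have : Fintype.card (Fin p → Fin L) ≤ n ^ (K * p) := by
        rw [pow_mul]; simpa using Nat.pow_le_pow_left hLn p
      exact_mod_cast this
    have h2 : (1 - κ / 16) ^ n ≤ ((n : ℝ) ^ (K * p + 1))⁻¹ := by
      calc (1 - κ / 16) ^ n ≤ Real.exp (-(κ / 16)) ^ n :=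
            pow_le_pow_left₀ (by linarith) (Real.one_sub_le_exp_neg _) n
        _ = Real.exp (-(((K * p + 1 : ℕ) : ℝ) * Real.log n)) := by
            rw [← Real.exp_nat_mul]
            congr 1
            have : (n : ℝ) * -(κ / 16) = -(κ * n / 16) := by ring
            rw [this, hκn, hC]
            push_cast
            ring
        _ = ((n : ℝ) ^ (K * p + 1))⁻¹ := by
            rw [Real.exp_neg, ← Real.log_pow, Real.exp_log (by positivity)]
    have h3 : 0 ≤ (1 - κ / 16) ^ n := pow_nonneg (by linarith) n
    calc (Fintype.card (Fin p → Fin L) : ℝ) * (1 - κ / 16) ^ n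
        ≤ (n : ℝ) ^ (K * p) * ((n : ℝ) ^ (K * p + 1))⁻¹ := by gcongr
      _ = 1 / n := by rw [pow_succ]; field_simp
      _ < 1 := by rw [div_lt_one hn0]; linarith
  obtain ⟨f, hf⟩ := exists_hitting_tuple G (κ / 16) hGcard n hunion
  obtain ⟨T, hT1, -, hT2⟩ := Finset.exists_subsuperset_card_eq (n := n)
    (s := Finset.univ.image fun i => tt (f i)) (t := Finset.range (q ^ p))
    (by
      intro t ht
      obtain ⟨i, -, rfl⟩ := Finset.mem_image.1 ht
      exact Finset.mem_range.2 (httlt _))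
    (Finset.card_image_le.trans (by simp))
    (by rw [Finset.card_range]; exact hnq.trans (Nat.le_self_pow hp.ne' q))
  refine ⟨T, hT2, α, hα0, fun a => ?_⟩
  obtain ⟨b, hb⟩ := exists_discrete_coeff hL0 (fun k : Fin p => a k)
  obtain ⟨i, hi⟩ := hf b
  obtain ⟨z, hz1, hz2⟩ := (Finset.mem_filter.1 hi).2
  obtain ⟨z', hz1', hz2'⟩ := hb (tt (f i)) ((q : ℝ) ^ (p * (p - 1))) (fun k => by
    have h1 : (tt (f i)) ^ (k : ℕ) ≤ (q ^ p) ^ (p - 1) :=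
      (Nat.pow_le_pow_left (httlt _).le _).trans
        (Nat.pow_le_pow_right (pow_pos hqp.pos _) (by have := k.2; omega))
    rw [← pow_mul] at h1
    exact_mod_cast h1)
  refine ⟨tt (f i), hT1 (Finset.mem_image_of_mem _ (Finset.mem_univ i)), z + z', ?_⟩
  have herr : (p : ℝ) * (q : ℝ) ^ (p * (p - 1)) / L ≤ 1 / q := by
    rw [div_le_div_iff₀ (by exact_mod_cast hL0) hq0, one_mul, hL]
    push_cast
    rw [mul_assoc, ← pow_succ]
    gcongr
    · linarith
    · obtain ⟨m, rfl⟩ : ∃ m, p = m + 1 := ⟨p - 1, by omega⟩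
      rw [Nat.add_sub_cancel, sq, mul_add, mul_one]; omega
  have hsum : (2 * (l : ℝ) + p) / q + 1 / q ≤ κ / 2 := by
    rw [← add_div, div_le_iff₀ hq0]
    linarith
  rw [Finset.sum_range]
  push_cast
  rw [abs_le]
  constructor <;> linarith

/-! ### Density of resonant sets -/

/-- The real numbers within `δ / 2` of an integer. With closed intervals centred at the integers
this set is symmetric, so that the signs of the monomials below do not matter. -/
def nearInt (δ : ℝ) : Set ℝ := {u | ∃ z : ℤ, |u - z| ≤ δ / 2}

theorem measurableSet_nearInt (δ : ℝ) : MeasurableSet (nearInt δ) := by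
  have : nearInt δ = ⋃ z : ℤ, {u : ℝ | |u - z| ≤ δ / 2} := by ext; simp [nearInt]
  rw [this]
  exact .iUnion fun z => measurableSet_le (by fun_prop) measurable_const

theorem neg_mem_nearInt {δ u : ℝ} (h : u ∈ nearInt δ) : -u ∈ nearInt δ := by
  obtain ⟨z, hz⟩ := h
  refine ⟨-z, ?_⟩
  rw [← abs_neg]
  push_cast
  convert hz using 2
  ring

theorem add_half_mem_nearInt {δ u : ℝ} (h : u ∉ nearInt δ) : u + 1 / 2 ∈ nearInt (1 - δ) := by
  simp only [nearInt, Set.mem_ofPred_eq, not_exists, not_le] at h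
  have h0 : (⌊u⌋ : ℝ) + Int.fract u = u := Int.floor_add_fract u
  have h1 := h ⌊u⌋
  have h2 := h (⌊u⌋ + 1)
  have h3 := Int.fract_nonneg u
  have h4 := Int.fract_lt_one u
  rw [abs_of_nonneg (by linarith)] at h1
  push_cast at h2
  rw [abs_of_nonpos (by linarith)] at h2
  refine ⟨⌊u⌋ + 1, ?_⟩
  push_cast
  rw [abs_le]
  constructor <;> linarith

/-- Equidistribution of `s ^ p` modulo one, upper bound. The set is a union of intervals
`[u ^ (1 / p), (u + δ) ^ (1 / p)]` with `u` in a progression of step one. As the root is concave,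
each is at most `δ` times as long as `[(u - 1) ^ (1 / p), u ^ (1 / p)]`, and these do not
overlap. -/
theorem volume_pow_add_mem_nearInt_le {p : ℕ} (hp : p ≠ 0) (c : ℝ) {δ S : ℝ} (hδ : 0 ≤ δ)
    (hδ1 : δ ≤ 1) (hS : 0 ≤ S) :
    volume {s : ℝ | 0 ≤ s ∧ s ≤ S ∧ s ^ p + c ∈ nearInt δ} ≤ ENNReal.ofReal (2 + δ * S) := by
  set z₀ : ℤ := ⌈c + δ / 2⌉ + 1 with hz₀
  set u : ℝ := z₀ - c - δ / 2 with hu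
  have hu1 : 1 ≤ u := by
    have := Int.le_ceil (c + δ / 2)
    rw [hu, hz₀]; push_cast; linarith
  have hu2 : u < 2 := by
    have := Int.ceil_lt_add_one (c + δ / 2)
    rw [hu, hz₀]; push_cast; linarith
  set g : ℝ → ℝ := fun v => v ^ ((p : ℝ)⁻¹) with hg
  have hp0 : (0 : ℝ) < (p : ℝ)⁻¹ := by positivity
  have hg_mono : ∀ {a b : ℝ}, 0 ≤ a → a ≤ b → g a ≤ g b := fun ha hab =>
    Real.rpow_le_rpow ha hab hp0.le
  have hg_pow : ∀ {s : ℝ}, 0 ≤ s → g (s ^ p) = s := fun hs => Real.pow_rpow_inv_natCast hs hp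
  have hg_conc : ConcaveOn ℝ (Set.Ici 0) g :=
    Real.concaveOn_rpow hp0.le (inv_le_one_of_one_le₀ (by exact_mod_cast Nat.one_le_iff_ne_zero.2 hp))
  set J : ℕ := ⌊S ^ p - u + 1⌋₊ with hJ
  have hcover : {s : ℝ | 0 ≤ s ∧ s ≤ S ∧ s ^ p + c ∈ nearInt δ} ⊆
      Set.Icc 0 2 ∪ ⋃ i ∈ Finset.range J, Set.Icc (g (u + i)) (g (u + i + δ)) := by
    rintro s ⟨hs0, hsS, z, hz⟩
    rw [abs_le] at hz
    -- The integers below `z₀` only account for `s ^ p < 2`.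
    rcases lt_or_ge z z₀ with hzz | hzz
    · left
      refine ⟨hs0, ?_⟩
      by_contra! h2
      have h3 : s ≤ s ^ p := le_self_pow₀ (by linarith) hp
      have h4 : (z : ℝ) + 1 ≤ z₀ := by exact_mod_cast hzz
      linarith
    · right
      obtain ⟨i, hi⟩ := Int.eq_ofNat_of_zero_le (sub_nonneg.2 hzz)
      have hi' : (z : ℝ) = z₀ + i := by
        have : z = z₀ + i := by linarith
        exact_mod_cast this
      have h1 : u + i ≤ s ^ p := by linarith
      have h2 : s ^ p ≤ u + i + δ := by linarith
      have h3 : s ^ p ≤ S ^ p := pow_le_pow_left₀ hs0 hsS p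
      refine Set.mem_biUnion (x := i) ?_ ⟨?_, ?_⟩
      · refine Finset.mem_coe.2 (Finset.mem_range.2 (Nat.lt_of_succ_le (Nat.le_floor ?_)))
        push_cast
        linarith
      · rw [← hg_pow hs0]; exact hg_mono (by positivity) h1
      · rw [← hg_pow hs0]; exact hg_mono (by positivity) h2
  have hlen : ∀ i : ℕ, g (u + i + δ) - g (u + i) ≤
      δ * (g (u - 1 + (i + 1 : ℕ)) - g (u - 1 + i)) := by
    intro i
    rcases hδ.eq_or_lt with rfl | hδ0
    · simp
    have hi : (0 : ℝ) ≤ i := Nat.cast_nonneg i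
    have := hg_conc.slope_anti_adjacent (x := u - 1 + i) (y := u + i) (z := u + i + δ)
      (Set.mem_Ici.2 (by linarith)) (Set.mem_Ici.2 (by linarith)) (by linarith) (by linarith)
    have e1 : u + i + δ - (u + i) = δ := by ring
    have e2 : u + i - (u - 1 + i) = 1 := by ring
    have e3 : u - 1 + ((i + 1 : ℕ) : ℝ) = u + i := by push_cast; ring
    rw [e1, e2, div_one, div_le_iff₀ hδ0] at this
    rw [e3]
    linarith
  have htel : ∑ i ∈ Finset.range J, (g (u + i + δ) - g (u + i)) ≤ δ * S := by
    refine (Finset.sum_le_sum fun i _ => hlen i).trans ?_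
    rw [← Finset.mul_sum, Finset.sum_range_sub (fun i : ℕ => g (u - 1 + i))]
    refine mul_le_mul_of_nonneg_left ?_ hδ
    rcases Nat.eq_zero_or_pos J with h | h
    · rw [h]; simpa using hS
    · have h1 : (J : ℝ) ≤ S ^ p - u + 1 := Nat.floor_le (by
        by_contra! hneg
        rw [hJ, Nat.floor_of_nonpos hneg.le] at h
        exact lt_irrefl _ h)
      have h2 : g (u - 1 + J) ≤ S := by
        rw [← hg_pow hS]
        exact hg_mono (by have : (0 : ℝ) ≤ J := Nat.cast_nonneg J
                          linarith) (by linarith)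
      have h3 : 0 ≤ g (u - 1 + (0 : ℕ)) := Real.rpow_nonneg (by simp; linarith) _
      linarith
  calc volume {s : ℝ | 0 ≤ s ∧ s ≤ S ∧ s ^ p + c ∈ nearInt δ}
      ≤ volume (Set.Icc (0 : ℝ) 2) +
        ∑ i ∈ Finset.range J, volume (Set.Icc (g (u + i)) (g (u + i + δ))) :=
        (measure_mono hcover).trans ((measure_union_le _ _).trans
          (add_le_add_right (measure_biUnion_finset_le _ _) _))
    _ = ENNReal.ofReal (2 + ∑ i ∈ Finset.range J, (g (u + i + δ) - g (u + i))) := by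
        have h0 : ∀ i ∈ Finset.range J, 0 ≤ g (u + i + δ) - g (u + i) := fun i _ =>
          sub_nonneg.2 (hg_mono (by positivity) (by linarith))
        rw [ENNReal.ofReal_add zero_le_two (Finset.sum_nonneg h0),
          ENNReal.ofReal_sum_of_nonneg h0]
        simp [Real.volume_Icc]
    _ ≤ _ := ENNReal.ofReal_le_ofReal (by linarith)

theorem volume_signed_pow_add_mem_nearInt_le {p : ℕ} (hp : p ≠ 0) {σ : ℝ} (hσ : σ = 1 ∨ σ = -1)
    (c : ℝ) {δ R : ℝ} (hδ : 0 ≤ δ) (hδ1 : δ ≤ 1) (hR : 0 ≤ R) :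
    volume {s : ℝ | s ∈ Set.Icc (-R / 2) (R / 2) ∧ σ * s ^ p + c ∈ nearInt δ} ≤
      ENNReal.ofReal (4 + δ * R) := by
  have half : ∀ σ' : ℝ, σ' = 1 ∨ σ' = -1 →
      volume {s : ℝ | 0 ≤ s ∧ s ≤ R / 2 ∧ σ' * s ^ p + c ∈ nearInt δ} ≤
        ENNReal.ofReal (2 + δ * (R / 2)) := by
    rintro _ (rfl | rfl)
    · simpa using volume_pow_add_mem_nearInt_le hp c hδ hδ1 (by positivity)
    · refine (measure_mono ?_).trans
        (volume_pow_add_mem_nearInt_le hp (-c) hδ hδ1 (by positivity))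
      rintro s ⟨h1, h2, h3⟩
      refine ⟨h1, h2, ?_⟩
      have := neg_mem_nearInt h3
      rwa [show -(-1 * s ^ p + c) = s ^ p + -c by ring] at this
  have hσ' : σ * (-1) ^ p = 1 ∨ σ * (-1) ^ p = -1 := by
    rcases hσ with rfl | rfl <;> rcases neg_one_pow_eq_or ℝ p with h | h <;> simp [h]
  have hsub : {s : ℝ | s ∈ Set.Icc (-R / 2) (R / 2) ∧ σ * s ^ p + c ∈ nearInt δ} ⊆
      {s : ℝ | 0 ≤ s ∧ s ≤ R / 2 ∧ σ * s ^ p + c ∈ nearInt δ} ∪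
      Neg.neg ⁻¹' {s : ℝ | 0 ≤ s ∧ s ≤ R / 2 ∧ σ * (-1) ^ p * s ^ p + c ∈ nearInt δ} := by
    rintro s ⟨⟨h1, h2⟩, h3⟩
    rcases le_total 0 s with h | h
    · exact Or.inl ⟨h, h2, h3⟩
    · refine Or.inr ⟨neg_nonneg.2 h, by linarith, ?_⟩
      rw [mul_assoc, ← mul_pow]
      simpa using h3
  refine (measure_mono hsub).trans ((measure_union_le _ _).trans ?_)
  rw [Measure.measure_preimage_neg]
  refine (add_le_add (half σ hσ) (half _ hσ')).trans ?_
  rw [← ENNReal.ofReal_add (by positivity) (by positivity)]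
  exact ENNReal.ofReal_le_ofReal (by linarith)

/-- The form `∑ i, τ i * x i ^ p`; for a suitable choice of signs `τ` it takes the value
`‖v‖_p ^ p` at `v`, and unlike the norm it is a polynomial for odd `p` too. -/
def powerForm {d : ℕ} (p : ℕ) (τ : Fin d → ℝ) (x : Fin d → ℝ) : ℝ := ∑ i, τ i * x i ^ p

theorem measurable_powerForm {d : ℕ} (p : ℕ) (τ : Fin d → ℝ) : Measurable (powerForm p τ) := by
  unfold powerForm; fun_prop

/-- The points at which `powerForm p τ + c` is within `δ / 2` of an integer. -/
def resonantSet {d : ℕ} (p : ℕ) (τ : Fin d → ℝ) (c δ : ℝ) : Set (Fin d → ℝ) :=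
  {x | powerForm p τ x + c ∈ nearInt δ}

theorem measurableSet_resonantSet {d : ℕ} (p : ℕ) (τ : Fin d → ℝ) (c δ : ℝ) :
    MeasurableSet (resonantSet p τ c δ) :=
  ((measurable_powerForm p τ).add_const c) (measurableSet_nearInt δ)

theorem volume_cube (d : ℕ) {R : ℝ} (hR : 0 ≤ R) :
    volume (Set.Icc (fun _ : Fin d => -R / 2) fun _ => R / 2) = ENNReal.ofReal (R ^ d) := by
  rw [Real.volume_Icc_pi, ENNReal.ofReal_pow hR]
  simp only [Finset.prod_const, Finset.card_univ, Fintype.card_fin]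
  congr 2
  ring

/-- Fubini reduces the density of a resonant set to the one-dimensional bound, which is uniform
in the shift. -/
theorem volume_resonantSet_inter_cube_le {d p : ℕ} (hp : p ≠ 0) {τ : Fin (d + 1) → ℝ}
    (hτ : ∀ i, τ i = 1 ∨ τ i = -1) (c : ℝ) {δ R : ℝ} (hδ : 0 ≤ δ) (hδ1 : δ ≤ 1) (hR : 0 ≤ R) :
    volume (resonantSet p τ c δ ∩ Set.Icc (fun _ => -R / 2) fun _ => R / 2) ≤
      ENNReal.ofReal ((4 + δ * R) * R ^ d) := by
  set B := resonantSet p τ c δ ∩ Set.Icc (fun _ : Fin (d + 1) => -R / 2) fun _ => R / 2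
  have hB : MeasurableSet B := (measurableSet_resonantSet p τ c δ).inter measurableSet_Icc
  set e := MeasurableEquiv.piFinSuccAbove (fun _ : Fin (d + 1) => ℝ) 0
  have he : MeasurePreserving e.symm :=
    (volume_preserving_piFinSuccAbove (fun _ : Fin (d + 1) => ℝ) 0).symm
  rw [← he.measure_preimage hB.nullMeasurableSet, Measure.volume_eq_prod,
    Measure.prod_apply_symm (e.symm.measurable hB)]
  set Q : Set (Fin d → ℝ) := Set.Icc (fun _ => -R / 2) fun _ => R / 2
  have hfib : ∀ y : Fin d → ℝ,
      volume ((fun s : ℝ => (s, y)) ⁻¹' (e.symm ⁻¹' B)) ≤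
        Q.indicator (fun _ => ENNReal.ofReal (4 + δ * R)) y := by
    intro y
    have hmem : ∀ s, s ∈ (fun s : ℝ => (s, y)) ⁻¹' (e.symm ⁻¹' B) ↔
        (Fin.cons s y : Fin (d + 1) → ℝ) ∈ B := fun s => by
      simp [e, MeasurableEquiv.piFinSuccAbove, Fin.insertNthEquiv]
    by_cases hy : y ∈ Q
    · rw [Set.indicator_of_mem hy]
      refine (measure_mono fun s hs => ?_).trans (volume_signed_pow_add_mem_nearInt_le hp (hτ 0)
        (∑ i : Fin d, τ i.succ * y i ^ p + c) hδ hδ1 hR)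
      obtain ⟨h1, h2, h3⟩ := (hmem s).1 hs
      refine ⟨⟨by simpa using h2 0, by simpa using h3 0⟩, ?_⟩
      simp only [resonantSet, powerForm, Set.mem_ofPred_eq, Fin.sum_univ_succ, Fin.cons_zero,
        Fin.cons_succ] at h1
      rwa [← add_assoc]
    · rw [Set.indicator_of_notMem hy, nonpos_iff_eq_zero]
      convert measure_empty (μ := (volume : Measure ℝ))
      refine Set.eq_empty_of_forall_notMem fun s hs => hy ?_
      obtain ⟨-, h2, h3⟩ := (hmem s).1 hs
      exact ⟨fun i => by simpa using h2 i.succ, fun i => by simpa using h3 i.succ⟩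
  refine (lintegral_mono hfib).trans ?_
  rw [lintegral_indicator measurableSet_Icc, setLIntegral_const, volume_cube d hR,
    ← ENNReal.ofReal_mul (by positivity)]

theorem cubeRatio_resonantSet_le {d p : ℕ} (hd : 1 ≤ d) (hp : p ≠ 0) {τ : Fin d → ℝ}
    (hτ : ∀ i, τ i = 1 ∨ τ i = -1) (c : ℝ) {δ R : ℝ} (hδ : 0 ≤ δ) (hδ1 : δ ≤ 1) (hR : 0 < R) :
    cubeRatio (resonantSet p τ c δ) R ≤ δ + 4 / R := by
  obtain ⟨d, rfl⟩ : ∃ k, d = k + 1 := ⟨d - 1, by omega⟩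
  rw [cubeRatio, div_le_iff₀ (by positivity)]
  refine (ENNReal.toReal_le_of_le_ofReal (by positivity)
    (volume_resonantSet_inter_cube_le hp hτ c hδ hδ1 hR.le)).trans (le_of_eq ?_)
  rw [pow_succ]
  field_simp
  ring

theorem cubeRatio_compl {d : ℕ} {B : Set (Fin d → ℝ)} (hB : MeasurableSet B) {R : ℝ}
    (hR : 0 < R) : cubeRatio Bᶜ R = 1 - cubeRatio B R := by
  set Q : Set (Fin d → ℝ) := Set.Icc (fun _ => -R / 2) fun _ => R / 2 with hQ
  have hQf : volume Q ≠ ⊤ := isCompact_Icc.measure_lt_top.ne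
  have hQr : volume.real Q = R ^ d := by
    rw [measureReal_def, hQ, volume_cube d hR.le, ENNReal.toReal_ofReal (by positivity)]
  have h : volume.real (Q ∩ B) + volume.real (Q \ B) = volume.real Q :=
    measureReal_inter_add_sdiff hB hQf
  have e1 : Bᶜ ∩ Q = Q \ B := by rw [Set.inter_comm, Set.sdiff_eq]
  rw [cubeRatio, cubeRatio, ← hQ, e1, Set.inter_comm B, eq_sub_iff_add_eq, ← add_div,
    div_eq_one_iff_eq (by positivity), ← hQr, ← h, add_comm]

theorem cubeRatio_mono {d : ℕ} {A B : Set (Fin d → ℝ)} (h : A ⊆ B) {R : ℝ} (hR : 0 < R) :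
    cubeRatio A R ≤ cubeRatio B R := by
  rw [cubeRatio, cubeRatio]
  gcongr
  exact ((measure_mono Set.inter_subset_right).trans_lt isCompact_Icc.measure_lt_top).ne

theorem cubeRatio_iUnion_le {d : ℕ} {ι : Type*} [Fintype ι] (B : ι → Set (Fin d → ℝ)) {R : ℝ}
    (hR : 0 < R) : cubeRatio (⋃ i, B i) R ≤ ∑ i, cubeRatio (B i) R := by
  simp only [cubeRatio]
  rw [← Finset.sum_div, Set.iUnion_inter]
  gcongr
  exact measureReal_iUnion_fintype_le _

theorem cubeRatio_nonneg {d : ℕ} (E : Set (Fin d → ℝ)) {R : ℝ} (hR : 0 < R) :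
    0 ≤ cubeRatio E R :=
  div_nonneg measureReal_nonneg (by positivity)

theorem tendsto_const_add_div_atTop (a b : ℝ) :
    Tendsto (fun R : ℝ => a + b / R) atTop (𝓝 a) := by
  simpa using (tendsto_const_nhds (x := b)).div_atTop tendsto_id |>.const_add a

/-- The lower bound for the density of the resonant set comes from the upper bound for its
complement, which lies in another resonant set. -/
theorem hasDensity_compl_resonantSet {d p : ℕ} (hd : 1 ≤ d) (hp : p ≠ 0) {τ : Fin d → ℝ}
    (hτ : ∀ i, τ i = 1 ∨ τ i = -1) (c : ℝ) {δ : ℝ} (hδ : 0 ≤ δ) (hδ1 : δ ≤ 1) :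
    HasDensity (resonantSet p τ c δ)ᶜ (1 - δ) := by
  refine tendsto_of_tendsto_of_tendsto_of_le_of_le' (tendsto_const_add_div_atTop (1 - δ) (-4))
    (tendsto_const_add_div_atTop (1 - δ) 4) ?_ ?_
  · filter_upwards [eventually_gt_atTop 0] with R hR
    rw [cubeRatio_compl (measurableSet_resonantSet p τ c δ) hR, neg_div]
    linarith [cubeRatio_resonantSet_le hd hp hτ c hδ hδ1 hR]
  · filter_upwards [eventually_gt_atTop 0] with R hR
    refine (cubeRatio_mono (B := resonantSet p τ (c + 1 / 2) (1 - δ)) (fun x hx => ?_) hR).trans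
      (cubeRatio_resonantSet_le hd hp hτ _ (by linarith) (by linarith) hR)
    have := add_half_mem_nearInt hx
    rwa [add_assoc] at this

theorem lowerDensity_compl_iUnion_resonantSet_ge {d p : ℕ} (hd : 1 ≤ d) (hp : p ≠ 0)
    {ι : Type*} [Fintype ι] {τ : ι → Fin d → ℝ} (hτ : ∀ s i, τ s i = 1 ∨ τ s i = -1) (c : ℝ)
    {δ : ℝ} (hδ : 0 ≤ δ) (hδ1 : δ ≤ 1) :
    1 - Fintype.card ι * δ ≤ lowerDensity (⋃ s, resonantSet p (τ s) c δ)ᶜ := by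
  set U := ⋃ s, resonantSet p (τ s) c δ
  have hU : MeasurableSet U := .iUnion fun s => measurableSet_resonantSet p (τ s) c δ
  have hlim := tendsto_const_add_div_atTop (1 - Fintype.card ι * δ) (-(4 * Fintype.card ι))
  rw [← hlim.liminf_eq]
  refine liminf_le_liminf ?_ hlim.isBoundedUnder_ge (IsBoundedUnder.isCoboundedUnder_ge ⟨1, ?_⟩)
  · filter_upwards [eventually_gt_atTop 0] with R hR
    have h1 : cubeRatio U R ≤ Fintype.card ι * (δ + 4 / R) := by
      refine (cubeRatio_iUnion_le _ hR).trans ((Finset.sum_le_card_nsmul _ _ (δ + 4 / R)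
        fun s _ => cubeRatio_resonantSet_le hd hp (hτ s) c hδ hδ1 hR).trans ?_)
      simp [mul_add]
    rw [cubeRatio_compl hU hR]
    have h2 : (Fintype.card ι : ℝ) * (4 / R) = 4 * Fintype.card ι / R := by ring
    rw [neg_div]
    linarith
  · rw [eventually_map]
    filter_upwards [eventually_gt_atTop 0] with R hR
    rw [cubeRatio_compl hU hR]
    linarith [cubeRatio_nonneg U hR]

/-! ### Isometric copies of collinear sets -/

theorem pNorm_pow_eq_sum {d p : ℕ} (hp : 0 < p) (x : Fin d → ℝ) :
    pNorm p x ^ p = ∑ i, |x i| ^ p := by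
  rw [pNorm_eq hp, one_div, Real.rpow_inv_natCast_pow _ hp.ne']
  exact Finset.sum_nonneg fun i _ => by positivity

theorem abs_add_pow_lt {p : ℕ} (hp : 2 ≤ p) {a b : ℝ} (hab : a ≠ b) :
    |a + b| ^ p < 2 ^ p * ((|a| ^ p + |b| ^ p) / 2) := by
  have key : (|a + b| / 2) ^ p < (|a| ^ p + |b| ^ p) / 2 := by
    by_cases h : |a| = |b|
    · have h1 : a = -b := (abs_eq_abs.1 h).resolve_left hab
      have hb : b ≠ 0 := fun hb => hab (by rw [h1, hb, neg_zero])
      have : 0 < |b| := abs_pos.2 hb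
      rw [h1, neg_add_cancel, abs_zero, zero_div, zero_pow (by omega), abs_neg]
      positivity
    · have h0 : (0 : ℝ) < 1 / 2 := by norm_num
      have h1 := (strictConvexOn_pow hp).2 (Set.mem_Ici.2 (abs_nonneg a))
        (Set.mem_Ici.2 (abs_nonneg b)) h h0 h0 (by norm_num)
      simp only [smul_eq_mul] at h1
      refine lt_of_le_of_lt ?_ (h1.trans_eq (by ring))
      gcongr
      linarith [abs_add_le a b]
  rw [div_pow, div_lt_iff₀ (by positivity)] at key
  linarith

theorem strictConvexSpace_piLp {d p : ℕ} (hp : 2 ≤ p) [Fact (1 ≤ (p : ENNReal))] :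
    StrictConvexSpace ℝ (PiLp (p : ENNReal) fun _ : Fin d => ℝ) := by
  have hpow : ∀ x : PiLp (p : ENNReal) fun _ : Fin d => ℝ, ‖x‖ ^ p = ∑ i, |x i| ^ p :=
    fun x => pNorm_pow_eq_sum (by omega) (WithLp.ofLp x)
  refine StrictConvexSpace.of_norm_add_ne_two fun x y hx hy hxy h => ?_
  obtain ⟨i, hi⟩ : ∃ i, x i ≠ y i := by
    by_contra! hcon
    exact hxy (PiLp.ext hcon)
  have h1 := hpow x
  have h2 := hpow y
  have h3 := hpow (x + y)
  rw [hx, one_pow] at h1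
  rw [hy, one_pow] at h2
  rw [h] at h3
  have h4 : ∑ i, |(x + y) i| ^ p < ∑ i, 2 ^ p * ((|x i| ^ p + |y i| ^ p) / 2) := by
    refine Finset.sum_lt_sum (fun j _ => ?_) ⟨i, Finset.mem_univ i, abs_add_pow_lt hp hi⟩
    by_cases hj : x j = y j
    · have : (x + y) j = 2 * y j := by rw [PiLp.add_apply, hj]; ring
      rw [this, hj, abs_mul, mul_pow, abs_two]
      exact le_of_eq (by ring)
    · exact (abs_add_pow_lt hp hj).le
  rw [← Finset.mul_sum, ← Finset.sum_div, Finset.sum_add_distrib, ← h1, ← h2, ← h3] at h4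
  norm_num at h4

/-- Strict convexity forces a scaled isometric image of collinear points to be an affine image. -/
theorem exists_eq_add_smul_of_dist_eq {E : Type*} [NormedAddCommGroup E] [NormedSpace ℝ E]
    [StrictConvexSpace ℝ E] {T : Finset ℕ} (hT : 2 ≤ T.card) {r : ℝ} (hr : 0 < r) (X : ℕ → E)
    (hX : ∀ s ∈ T, ∀ t ∈ T, dist (X s) (X t) = r * |(s : ℝ) - t|) :
    ∃ y v : E, ‖v‖ = 1 ∧ ∀ t ∈ T, X t = y + (r * t) • v := by
  have hne : T.Nonempty := Finset.card_pos.1 (by omega)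
  obtain ⟨a, ha, ha'⟩ : ∃ a ∈ T, ∀ t ∈ T, a ≤ t := ⟨_, T.min'_mem hne, fun t ht => T.min'_le t ht⟩
  obtain ⟨b, hb, hb'⟩ : ∃ b ∈ T, ∀ t ∈ T, t ≤ b := ⟨_, T.max'_mem hne, fun t ht => T.le_max' t ht⟩
  have hab : a < b := by
    by_contra! h
    have : T ⊆ {a} := fun t ht =>
      Finset.mem_singleton.2 (le_antisymm ((hb' t ht).trans h) (ha' t ht))
    have := Finset.card_le_card this
    rw [Finset.card_singleton] at this
    omega
  have hab' : (0 : ℝ) < b - a := sub_pos.2 (by exact_mod_cast hab)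
  have hd : dist (X a) (X b) = r * (b - a) := by
    rw [hX a ha b hb, abs_sub_comm, abs_of_pos hab']
  set v : E := (r * (b - a))⁻¹ • (X b - X a) with hv
  refine ⟨X a - (r * a) • v, v, ?_, fun t ht => ?_⟩
  · rw [hv, norm_smul, ← dist_eq_norm, dist_comm, hd, Real.norm_of_nonneg (by positivity)]
    exact inv_mul_cancel₀ (by positivity)
  · have h1 : (0 : ℝ) ≤ t - a := sub_nonneg.2 (by exact_mod_cast ha' t ht)
    have h2 : (0 : ℝ) ≤ b - t := sub_nonneg.2 (by exact_mod_cast hb' t ht)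
    have h3 : X t = AffineMap.lineMap (X a) (X b) (((t : ℝ) - a) / (b - a)) := by
      apply eq_lineMap_of_dist_eq_mul_of_dist_eq_mul
      · rw [hd, hX a ha t ht, abs_sub_comm, abs_of_nonneg h1]
        field_simp
      · rw [hd, hX t ht b hb, abs_sub_comm, abs_of_nonneg h2]
        field_simp
        ring
    have h4 : X b - X a = (r * (b - a)) • v := by
      rw [hv, smul_inv_smul₀ (by positivity)]
    rw [h3, AffineMap.lineMap_apply_module', h4, smul_smul,
      show ((t : ℝ) - a) / (b - a) * (r * (b - a)) = r * t - r * a by field_simp, sub_smul]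
    abel

/-- Along a line, `powerForm p τ` is a polynomial whose leading coefficient is its value at the
direction. -/
theorem powerForm_add_smul {d : ℕ} (p : ℕ) (τ y v : Fin d → ℝ) (r : ℝ) :
    ∃ a : ℕ → ℝ, ∀ t : ℝ, powerForm p τ (y + (r * t) • v) =
      r ^ p * powerForm p τ v * t ^ p + ∑ k ∈ Finset.range p, a k * t ^ k := by
  refine ⟨fun k => ∑ i, τ i * ((r * v i) ^ k * y i ^ (p - k) * (p.choose k)), fun t => ?_⟩
  have h1 : ∀ i, τ i * (y + (r * t) • v) i ^ p = r ^ p * (τ i * v i ^ p) * t ^ p +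
      ∑ k ∈ Finset.range p, τ i * ((r * v i) ^ k * y i ^ (p - k) * (p.choose k)) * t ^ k := by
    intro i
    rw [Pi.add_apply, Pi.smul_apply, smul_eq_mul, add_comm, add_pow, Finset.sum_range_succ,
      mul_add, add_comm, Finset.mul_sum]
    congr 1
    · simp only [tsub_self, pow_zero, mul_one, Nat.choose_self, Nat.cast_one, mul_pow]
      ring
    · refine Finset.sum_congr rfl fun k _ => ?_
      rw [show r * t * v i = r * v i * t by ring, mul_pow _ t]
      ring
  unfold powerForm
  rw [Finset.sum_congr rfl fun i _ => h1 i, Finset.sum_add_distrib, Finset.sum_comm,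
    ← Finset.sum_mul, ← Finset.mul_sum]
  congr 1
  exact Finset.sum_congr rfl fun k _ => (Finset.sum_mul _ _ _).symm

/-- The points of a hitting set, placed on a coordinate axis, together with the dilation factors
`(α + j + 1) ^ (1 / p)`: whatever its direction, a copy meets one of the resonant sets. Adding an
integer to the leading coefficient does not matter, because the parameters are integers. -/
theorem exists_collinear_avoiding {d p : ℕ} (hd : 1 ≤ d) (hp : 2 ≤ p) {ι : Type*}
    (τ : ι → Fin d → ℝ) (hτ : ∀ v : Fin d → ℝ, pNorm p v = 1 → ∃ s, powerForm p (τ s) v = 1)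
    {T : Finset ℕ} (hT : 2 ≤ T.card) {α δ : ℝ} (hα : 0 < α)
    (hit : ∀ a : ℕ → ℝ, ∃ t ∈ T, ∃ z : ℤ,
      |α * (t : ℝ) ^ p + ∑ k ∈ Finset.range p, a k * (t : ℝ) ^ k - z| ≤ δ / 2) :
    ∃ (P : Finset (Fin d → ℝ)) (r : ℕ → ℝ), P.card = T.card ∧
      Collinear ℝ (P : Set (Fin d → ℝ)) ∧ (∀ j, 0 < r j) ∧ Tendsto r atTop atTop ∧
      ∀ j, ¬ ContainsCopy p (r j) (P : Set (Fin d → ℝ)) (⋃ s, resonantSet p (τ s) 0 δ)ᶜ := by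
  classical
  have : Fact (1 ≤ (p : ENNReal)) := ⟨by exact_mod_cast (by omega : 1 ≤ p)⟩
  have := strictConvexSpace_piLp (d := d) hp
  have hp0 : p ≠ 0 := by omega
  set i₀ : Fin d := ⟨0, hd⟩
  set pt : ℕ → Fin d → ℝ := fun t => Pi.single i₀ (t : ℝ) with hpt
  have hpt_inj : Function.Injective pt := fun s t h => by
    exact_mod_cast Pi.single_injective (M := fun _ => ℝ) i₀ h
  set r : ℕ → ℝ := fun j => (α + (j + 1)) ^ ((p : ℝ)⁻¹) with hr
  have hrpow : ∀ j, r j ^ p = α + (j + 1) := fun j =>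
    Real.rpow_inv_natCast_pow (by positivity) hp0
  have hrpos : ∀ j, 0 < r j := fun j => Real.rpow_pos_of_pos (by positivity) _
  refine ⟨T.image pt, r, Finset.card_image_of_injective _ hpt_inj, ?_, hrpos, ?_, ?_⟩
  · rw [collinear_iff_exists_forall_eq_smul_vadd]
    refine ⟨0, Pi.single i₀ 1, fun x hx => ?_⟩
    obtain ⟨t, -, rfl⟩ := Finset.mem_image.1 (Finset.mem_coe.1 hx)
    exact ⟨t, by rw [hpt, vadd_eq_add, add_zero, ← Pi.single_smul, smul_eq_mul, mul_one]⟩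
  · refine (tendsto_rpow_atTop (by positivity : (0 : ℝ) < (p : ℝ)⁻¹)).comp ?_
    exact tendsto_atTop_add_const_left _ _
      (tendsto_atTop_add_const_right _ _ tendsto_natCast_atTop_atTop)
  · rintro j ⟨Y, hYE, φ, hφ, hiso⟩
    obtain ⟨y, v, hv, hline⟩ := exists_eq_add_smul_of_dist_eq hT (hrpos j)
      (fun t => (WithLp.toLp (p : ENNReal) (φ (pt t)) : PiLp (p : ENNReal) fun _ : Fin d => ℝ))
      (by
        intro s hs t ht
        have h1 := hiso (pt s) (Finset.mem_coe.2 (Finset.mem_image_of_mem _ hs))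
          (pt t) (Finset.mem_coe.2 (Finset.mem_image_of_mem _ ht))
        rw [dist_eq_norm, ← WithLp.toLp_sub]
        have h2 : pt s - pt t = Pi.single i₀ ((s : ℝ) - t) := (Pi.single_sub i₀ _ _).symm
        rw [h2, pNorm, pNorm, PiLp.toLp_single, PiLp.norm_single, Real.norm_eq_abs] at h1
        exact h1)
    obtain ⟨s, hs⟩ := hτ (WithLp.ofLp v) hv
    obtain ⟨a, ha⟩ := powerForm_add_smul p (τ s) (WithLp.ofLp y) (WithLp.ofLp v) (r j)
    obtain ⟨t, ht, z, hz⟩ := hit a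
    have hφt : φ (pt t) = WithLp.ofLp y + (r j * t) • WithLp.ofLp v :=
      congrArg WithLp.ofLp (hline t ht)
    refine hYE (hφ.mapsTo (Finset.mem_coe.2 (Finset.mem_image_of_mem pt ht)))
      (Set.mem_iUnion.2 ⟨s, z + (j + 1) * t ^ p, ?_⟩)
    rw [hφt, ha, hs, hrpow]
    refine le_of_eq_of_le ?_ hz
    push_cast
    congr 1
    ring

end LpDensity

theorem theorem2 (p : ℕ) (hp : 2 ≤ p) :
    (∀ d : ℕ, 1 ≤ d → ∃ C : ℝ, 0 < C ∧ ∃ N : ℕ, ∀ n : ℕ, N ≤ n →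
      ∃ (E : Set (Fin d → ℝ)) (P : Finset (Fin d → ℝ)) (r : ℕ → ℝ),
        MeasurableSet E ∧
        P.card = n ∧ Collinear ℝ (P : Set (Fin d → ℝ)) ∧
        (∀ j, 0 < r j) ∧ Tendsto r atTop atTop ∧
        1 - C * (Real.log n / n) ≤ LpDensity.lowerDensity E ∧
        ∀ j, ¬ LpDensity.ContainsCopy p (r j) (P : Set (Fin d → ℝ)) E) ∧
    (Even p → ∃ C : ℝ, 0 < C ∧ ∃ N : ℕ, ∀ d : ℕ, 1 ≤ d → ∀ n : ℕ, N ≤ n →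
      ∃ (E : Set (Fin d → ℝ)) (P : Finset (Fin d → ℝ)) (r : ℕ → ℝ),
        MeasurableSet E ∧
        P.card = n ∧ Collinear ℝ (P : Set (Fin d → ℝ)) ∧
        (∀ j, 0 < r j) ∧ Tendsto r atTop atTop ∧
        (∃ δ : ℝ, LpDensity.HasDensity E δ ∧ 1 - C * (Real.log n / n) ≤ δ) ∧
        ∀ j, ¬ LpDensity.ContainsCopy p (r j) (P : Set (Fin d → ℝ)) E) := by
  have hp0 : p ≠ 0 := by omega
  obtain ⟨C, hC, N, hN⟩ := LpDensity.exists_hitting_finset p (by omega)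
  have hδ : ∀ n : ℕ, 0 ≤ C * (Real.log n / n) := fun n =>
    mul_nonneg hC.le (div_nonneg (Real.log_natCast_nonneg n) (Nat.cast_nonneg n))
  refine ⟨fun d hd => ⟨2 ^ d * C, by positivity, max N 2, fun n hn => ?_⟩,
    fun heven => ⟨C, hC, max N 2, fun d hd n hn => ?_⟩⟩
  · obtain ⟨hδ1, T, hT, α, hα, hit⟩ := hN n (le_of_max_le_left hn)
    -- For odd `p` every sign pattern is used, as that of the direction of a copy is unknown.
    set τ : (Fin d → Bool) → Fin d → ℝ := fun s i => if s i then 1 else -1 with hτ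
    have hτ1 : ∀ s i, τ s i = 1 ∨ τ s i = -1 := fun s i => by
      simp only [hτ]; split_ifs <;> simp
    have hτ2 : ∀ v : Fin d → ℝ, LpDensity.pNorm p v = 1 →
        ∃ s, LpDensity.powerForm p (τ s) v = 1 := by
      intro v hv
      refine ⟨fun i => decide (0 ≤ v i ^ p), ?_⟩
      rw [← one_pow p, ← hv, LpDensity.pNorm_pow_eq_sum (by omega)]
      refine Finset.sum_congr rfl fun i _ => ?_
      rw [← abs_pow]
      by_cases h : 0 ≤ v i ^ p
      · simp [hτ, h, abs_of_nonneg h]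
      · simp [hτ, h, abs_of_neg (not_le.1 h)]
    obtain ⟨P, r, hP, hcol, hr, hr', hav⟩ := LpDensity.exists_collinear_avoiding hd hp τ hτ2
      (hT ▸ le_of_max_le_right hn) hα hit
    refine ⟨_, P, r, ?_, hP.trans hT, hcol, hr, hr', ?_, hav⟩
    · exact (MeasurableSet.iUnion fun s => LpDensity.measurableSet_resonantSet p (τ s) 0 _).compl
    · refine le_trans (le_of_eq ?_) (LpDensity.lowerDensity_compl_iUnion_resonantSet_ge hd hp0 hτ1 0
        (hδ n) hδ1)
      simp [mul_assoc]
  · obtain ⟨hδ1, T, hT, α, hα, hit⟩ := hN n (le_of_max_le_left hn)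
    have hτ2 : ∀ v : Fin d → ℝ, LpDensity.pNorm p v = 1 →
        ∃ _s : Unit, LpDensity.powerForm p (fun _ => 1) v = 1 := by
      intro v hv
      have h := LpDensity.pNorm_pow_eq_sum (p := p) (by omega) v
      rw [hv, one_pow] at h
      refine ⟨(), Eq.trans ?_ h.symm⟩
      exact Finset.sum_congr rfl fun i _ => by simp [heven.pow_abs]
    obtain ⟨P, r, hP, hcol, hr, hr', hav⟩ := LpDensity.exists_collinear_avoiding hd hp
      (fun _ : Unit => fun _ => 1) hτ2 (hT ▸ le_of_max_le_right hn) hα hit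
    rw [Set.iUnion_const] at hav
    exact ⟨_, P, r, (LpDensity.measurableSet_resonantSet p _ 0 _).compl, hP.trans hT, hcol, hr, hr',
      ⟨_, LpDensity.hasDensity_compl_resonantSet hd hp0 (fun _ => Or.inl rfl) 0 (hδ n) hδ1, le_rfl⟩,
      hav⟩
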